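/- Let $\mathcal L$ be a first-order language, possibly containing a predicate $\approx$. Interpretations of $\mathcal L$ are taken under the standard name assumption: they are Herbrand interpretations over the ground terms of $\mathcal L$ extended by countably infinitely many additional constants, with $\approx$ (if present) interpreted as a congruence relation; $\models$ and satisfiability refer to these interpretations. Let $\mathcal K=(\mathcal O,\mathcal P)$ be a hybrid MKNF knowledge base: $\mathcal O$ is a description logic knowledge base with first-order translation the sentence $\pi(\mathcal O)$, and $\mathcal P$ is a finite set of ground rules $r=\mathbf K H\leftarrow \mathbf K A_1,\dots,\mathbf K A_m,\mathbf{not}\,B_1,\dots,\mathbf{not}\,B_n$ with function-free ground atoms $H,A_i,B_j$. Put $hd(r)=\mathbf K H$, $bd^+(r)=\{\mathbf K A_i\}$, $\mathbf K(bd^-(r))=\{\mathbf K B_j\}$; $r$ is positive if $n=0$. $\mathcal K$ is identified with the MKNF formula $\pi(\mathcal K)=\mathbf K\pi(\mathcal O)\wedge\bigwedge_{r\in\mathcal P}(\mathbf K A_1\wedge\dots\wedge\mathbf{not}\,B_n\supset\mathbf K H)$. Let $KA(\mathcal K)$ be the set of all $\mathbf K\phi$ such that $\mathbf K\phi$ or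 $\mathbf{not}\,\phi$ occurs in $\mathcal P$, and for $S\subseteq KA(\mathcal K)$ let $OB_{\mathcal O,S}=\{\pi(\mathcal O)\}\cup\{\xi\mid\mathbf K\xi\in S\}$. An MKNF interpretation pair is a pair $(M,N)$ of sets of interpretations with $\emptyset\subset N\subseteq M$. Formulas are evaluated in $(I,\langle M,M_1\rangle,\langle N,N_1\rangle)$ with truth values $\mathbf f<\mathbf u<\mathbf t$: first-order atoms by $I$; $\neg$ exchanges $\mathbf t$ and $\mathbf f$ and fixes $\mathbf u$; $\wedge$ is the minimum; $\exists x$ is the maximum over all names; $\varphi\supset\psi$ is $\mathbf t$ if the value of $\psi$ is at least that of $\varphi$, and $\mathbf f$ otherwise; $\mathbf K\varphi$ is $\mathbf t$ if $\varphi$ is $\mathbf t$ for all $J\in M$, $\mathbf f$ if $\varphi$ is $\mathbf f$ for some $J\in M_1$, and $\mathbf u$ otherwise; $\mathbf{not}\,\varphi$ is $\mathbf t$ if $\varphi$ is $\mathbf f$ for some $J\in N_1$, $\mathbf f$ if $\varphi$ is $\mathbf t$ for all $J\in N$, and $\mathbf u$ otherwise. A pair $(M,N)$ is a three-valued MKNF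 model of $\mathcal K$ if $\pi(\mathcal K)$ is $\mathbf t$ in $(I,\langle M,N\rangle,\langle M,N\rangle)$ for all $I\in M$, and for all interpretation pairs $(M',N')$ with $M\subseteq M'$, $N\subseteq N'$, at least one inclusion proper, and $M'=N'$ if $M=N$, there is $I'\in M'$ such that $\pi(\mathcal K)$ is not $\mathbf t$ in $(I',\langle M',N'\rangle,\langle M,N\rangle)$. A partition is a pair $(T,P)$ of subsets of $KA(\mathcal K)$; it is consistent if $T\subseteq P$. The pair $(M,N)$ induces $(T,P)$ if $T$, $P\setminus T$ and $KA(\mathcal K)\setminus P$ are the sets of $\mathbf K\xi\in KA(\mathcal K)$ with value $\mathbf t$, $\mathbf u$ and $\mathbf f$, respectively, in $(I,\langle M,N\rangle,\langle M,N\rangle)$ for all $I\in M$. Define $\Psi_{\mathcal K}$ on pairs of subsets of $KA(\mathcal K)$ by $$\Psi_{\mathcal K}(T,P)_1=\{\mathbf K a\in KA(\mathcal K)\mid OB_{\mathcal O,T}\models a\}\cup\{hd(r)\mid r\in\mathcal P,\ bd^+(r)\subseteq T,\ \mathbf K(bd^-(r))\cap P=\emptyset\},$$ and let $\Psi_{\mathcal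 K}(T,P)_2$ be the union of $\{\mathbf K a\in KA(\mathcal K)\mid OB_{\mathcal O,P}\models a\}$ and the set of all $hd(r)=\mathbf K a$, $r\in\mathcal P$, such that $OB_{\mathcal O,T}\not\models\neg a$, $bd^+(r)\subseteq P$, $\mathbf K(bd^-(r))\cap T=\emptyset$, and there is no positive rule $r'\in\mathcal P$ with head $\mathbf K b$ such that $\mathbf K a\in bd^+(r')$, $OB_{\mathcal O,T}\models\neg b$ and $bd^+(r')\setminus\{\mathbf K a\}\subseteq T$. Then $\Psi_{\mathcal K}$ is monotone for the precision order ($(T,P)\le_p(T',P')$ iff $T\subseteq T'$ and $P'\subseteq P$), so $\Psi_{\mathcal K}(\cdot,P)_1$ and $\Psi_{\mathcal K}(T,\cdot)_2$ are monotone and have least fixpoints. A partition $(T,P)$ is a consistent stable fixpoint of $\Psi_{\mathcal K}$ if $T\subseteq P$, $T=\mathrm{lfp}(\Psi_{\mathcal K}(\cdot,P)_1)$ and $P=\mathrm{lfp}(\Psi_{\mathcal K}(T,\cdot)_2)$. **Theorem.** Let $(T,P)$ be a partition and $(M,N)=(\{I\mid I\models OB_{\mathcal O,T}\},\{I\mid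 I\models OB_{\mathcal O,P}\})$. Then $(M,N)$ is a three-valued MKNF model of $\mathcal K$ which induces the partition $(T,P)$ if and only if $(T,P)$ is a consistent stable fixpoint of $\Psi_{\mathcal K}$ and $OB_{\mathcal O,\mathrm{lfp}(\Psi_{\mathcal K}(\cdot,T)_1)}$ is satisfiable. The equivalence holds both when the two least fixpoints in the definition of a consistent stable fixpoint are taken on the whole power set of $KA(\mathcal K)$, and when they are taken on the intervals $[\emptyset,P]$ and $[T,KA(\mathcal K)]$ (the two operators being required to map these intervals into themselves). -/

import Mathlib

noncomputable section

namespace HybridMKNF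

universe u v w

/-! ### Approximation fixpoint theory on the product bilattice -/

/-- The precision order on pairs: `(x, y) ≤ₚ (x', y')` iff `x ≤ x'` and `y' ≤ y`. -/
def PrecLE {L : Type w} [LE L] (p q : L × L) : Prop := p.1 ≤ q.1 ∧ q.2 ≤ p.2

/-- Approximators on `L × L`: monotone for the precision order, and mapping an exact pair to an
exact pair whenever its image is consistent. -/
structure Approximator (L : Type w) [CompleteLattice L] where
  toFun : L × L → L × L
  mono : ∀ p q, PrecLE p q → PrecLE (toFun p) (toFun q)
  exact : ∀ x, (toFun (x, x)).1 ≤ (toFun (x, x)).2 → (toFun (x, x)).1 = (toFun (x, x)).2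

namespace Approximator

variable {L : Type w} [CompleteLattice L]

/-- The projection operator `A(·, y)₁` on `L`. -/
def fst (A : Approximator L) (y : L) : L →o L where
  toFun z := (A.toFun (z, y)).1
  monotone' _ _ h := (A.mono _ _ ⟨h, le_refl y⟩).1

/-- The projection operator `A(x, ·)₂` on `L`. -/
def snd (A : Approximator L) (x : L) : L →o L where
  toFun z := (A.toFun (x, z)).2
  monotone' _ _ h := (A.mono _ _ ⟨le_refl x, h⟩).2

/-- The stable revision operator `St_A(x, y) = (lfp A(·, y)₁, lfp A(x, ·)₂)`, both least fixpoints
being taken on the whole lattice `L`. -/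
def stableRevision (A : Approximator L) (p : L × L) : L × L :=
  ((A.fst p.2).lfp, (A.snd p.1).lfp)

/-- `(x, y)` is consistent and a fixpoint of the stable revision operator. -/
def IsConsistentStable (A : Approximator L) (x y : L) : Prop :=
  x ≤ y ∧ A.stableRevision (x, y) = (x, y)

/-- `f` restricts to an operator on `D`, whose least fixpoint is `x`. -/
def IsLfpOn (f : L → L) (D : Set L) (x : L) : Prop :=
  Set.MapsTo f D D ∧ IsLeast {z | z ∈ D ∧ f z = z} x

/-- The variant of consistent stable fixpoints in which `A(·, y)₁` is taken as an operator on the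
interval `[⊥, y]` and `A(x, ·)₂` as an operator on the interval `[x, ⊤]`. -/
def IsConsistentStableOnIntervals (A : Approximator L) (x y : L) : Prop :=
  x ≤ y ∧ IsLfpOn (A.fst y) (Set.Icc ⊥ y) x ∧ IsLfpOn (A.snd x) (Set.Icc x ⊤) y

end Approximator

/-! ### First-order interpretations under the standard name assumption -/

/-- A first-order language, possibly with a distinguished binary predicate `≈`. -/
structure Signature where
  lang : FirstOrder.Language.{u, v}
  eqSymb : Option (lang.Relations 2)

/-- The Herbrand universe: ground terms over the language extended by countably many additional
constants (`Term.var i` is the `i`-th additional constant). -/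
abbrev Name (S : Signature.{u, v}) : Type u := S.lang.Term ℕ

/-- `e` is interpreted as a congruence relation. -/
def IsCongruence {S : Signature.{u, v}}
    (rel : ∀ {k : ℕ}, S.lang.Relations k → (Fin k → Name S) → Prop)
    (e : S.lang.Relations 2) : Prop :=
  Equivalence (fun a b => rel e ![a, b]) ∧
  (∀ (k : ℕ) (g : S.lang.Functions k) (a b : Fin k → Name S),
    (∀ i, rel e ![a i, b i]) →
      rel e ![FirstOrder.Language.Term.func g a, FirstOrder.Language.Term.func g b]) ∧
  (∀ (k : ℕ) (R : S.lang.Relations k) (a b : Fin k → Name S),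
    (∀ i, rel e ![a i, b i]) → rel R a → rel R b)

/-- Herbrand interpretations, in which `≈` (if present) is a congruence relation. -/
structure Interp (S : Signature.{u, v}) where
  rel : ∀ {k : ℕ}, S.lang.Relations k → (Fin k → Name S) → Prop
  congr : ∀ e, S.eqSymb = some e → IsCongruence rel e

/-- First-order formulas with free variables among `Fin n`; the other connectives and the
universal quantifier are the usual abbreviations. -/
inductive FOFormula (S : Signature.{u, v}) : ℕ → Type (max u v)
  | top {n : ℕ} : FOFormula S n
  | atom {n k : ℕ} (R : S.lang.Relations k) (ts : Fin k → S.lang.Term (Fin n)) : FOFormula S n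
  | neg {n : ℕ} (φ : FOFormula S n) : FOFormula S n
  | and {n : ℕ} (φ ψ : FOFormula S n) : FOFormula S n
  | ex {n : ℕ} (φ : FOFormula S (n + 1)) : FOFormula S n

/-- Satisfaction of a first-order formula, with names `val i` for its free variables. -/
def FOFormula.Holds {S : Signature.{u, v}} (I : Interp S) :
    {n : ℕ} → FOFormula S n → (Fin n → Name S) → Prop
  | _, .top, _ => True
  | _, .atom R ts, val => I.rel R (fun i => (ts i).subst val)
  | _, .neg φ, val => ¬ φ.Holds I val
  | _, .and φ ψ, val => φ.Holds I val ∧ ψ.Holds I val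
  | _, .ex φ, val => ∃ α : Name S, φ.Holds I (Fin.snoc val α)

/-- `I ⊨ Γ` for a set of first-order sentences. -/
def Interp.Models {S : Signature.{u, v}} (I : Interp S) (Γ : Set (FOFormula S 0)) : Prop :=
  ∀ ξ ∈ Γ, ξ.Holds I Fin.elim0

/-- `Γ ⊨ ξ`. -/
def Entails {S : Signature.{u, v}} (Γ : Set (FOFormula S 0)) (ξ : FOFormula S 0) : Prop :=
  ∀ I : Interp S, I.Models Γ → ξ.Holds I Fin.elim0

def Satisfiable {S : Signature.{u, v}} (Γ : Set (FOFormula S 0)) : Prop :=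
  ∃ I : Interp S, I.Models Γ

/-! ### The three-valued logic of minimal knowledge and negation as failure -/

/-- The truth values `f < u < t`. -/
abbrev TruthVal : Type := Fin 3

abbrev ff : TruthVal := 0
abbrev uu : TruthVal := 1
abbrev tt : TruthVal := 2

/-- MKNF formulas with free variables among `Fin n`. -/
inductive MFormula (S : Signature.{u, v}) : ℕ → Type (max u v)
  | top {n : ℕ} : MFormula S n
  | atom {n k : ℕ} (R : S.lang.Relations k) (ts : Fin k → S.lang.Term (Fin n)) : MFormula S n
  | neg {n : ℕ} (φ : MFormula S n) : MFormula S n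
  | and {n : ℕ} (φ ψ : MFormula S n) : MFormula S n
  | imp {n : ℕ} (φ ψ : MFormula S n) : MFormula S n
  | ex {n : ℕ} (φ : MFormula S (n + 1)) : MFormula S n
  | knows {n : ℕ} (φ : MFormula S n) : MFormula S n
  | naf {n : ℕ} (φ : MFormula S n) : MFormula S n

/-- A first-order formula as an MKNF formula. -/
def FOFormula.toM {S : Signature.{u, v}} : {n : ℕ} → FOFormula S n → MFormula S n
  | _, .top => .top
  | _, .atom R ts => .atom R ts
  | _, .neg φ => .neg φ.toM
  | _, .and φ ψ => .and φ.toM ψ.toM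
  | _, .ex φ => .ex φ.toM

open Classical in
/-- The truth value of a formula in the three-valued MKNF structure `(I, 𝓜, 𝓝)`, where
`𝓜 = ⟨M, M₁⟩` and `𝓝 = ⟨N, N₁⟩`; `val` gives the names substituted for the free variables. -/
def MFormula.eval {S : Signature.{u, v}} (MM NN : Set (Interp S) × Set (Interp S)) :
    {n : ℕ} → MFormula S n → Interp S → (Fin n → Name S) → TruthVal
  | _, .top, _, _ => tt
  | _, .atom R ts, I, val => if I.rel R (fun i => (ts i).subst val) then tt else ff
  | _, .neg φ, I, val =>
      if φ.eval MM NN I val = ff then tt else if φ.eval MM NN I val = uu then uu else ff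
  | _, .and φ ψ, I, val => min (φ.eval MM NN I val) (ψ.eval MM NN I val)
  | _, .imp φ ψ, I, val => if φ.eval MM NN I val ≤ ψ.eval MM NN I val then tt else ff
  | _, .ex φ, I, val => ⨆ α : Name S, φ.eval MM NN I (Fin.snoc val α)
  | _, .knows φ, _, val =>
      if ∀ J ∈ MM.1, φ.eval MM NN J val = tt then tt
      else if ∃ J ∈ MM.2, φ.eval MM NN J val = ff then ff
      else uu
  | _, .naf φ, _, val =>
      if ∃ J ∈ NN.2, φ.eval MM NN J val = ff then tt
      else if ∀ J ∈ NN.1, φ.eval MM NN J val = tt then ff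
      else uu

/-- MKNF interpretation pairs: `∅ ⊂ N ⊆ M`. -/
def IsInterpPair {S : Signature.{u, v}} (M N : Set (Interp S)) : Prop :=
  N.Nonempty ∧ N ⊆ M

/-- Three-valued MKNF models of a sentence. -/
def IsThreeValuedModel {S : Signature.{u, v}} (M N : Set (Interp S)) (φ : MFormula S 0) : Prop :=
  IsInterpPair M N ∧
  (∀ I ∈ M, φ.eval (M, N) (M, N) I Fin.elim0 = tt) ∧
  ∀ M' N' : Set (Interp S), IsInterpPair M' N' → M ⊆ M' → N ⊆ N' → (M ≠ M' ∨ N ≠ N') →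
    (M = N → M' = N') → ∃ I' ∈ M', φ.eval (M', N') (M, N) I' Fin.elim0 ≠ tt

/-! ### Hybrid MKNF knowledge bases -/

/-- Function-free ground first-order atoms. The modal atom `K φ` is represented by `φ`. -/
structure GroundAtom (S : Signature.{u, v}) where
  arity : ℕ
  pred : S.lang.Relations arity
  args : Fin arity → S.lang.Constants

def GroundAtom.toFO {S : Signature.{u, v}} (a : GroundAtom S) : FOFormula S 0 :=
  .atom a.pred (fun i => (a.args i).term)

/-- Ground rules `K H ← K A₁, …, K Aₘ, not B₁, …, not Bₙ`. -/
structure Rule (S : Signature.{u, v}) where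
  head : GroundAtom S
  pos : List (GroundAtom S)
  neg : List (GroundAtom S)

/-- Conjunction of a list of formulas. -/
def MFormula.conj {S : Signature.{u, v}} {n : ℕ} (l : List (MFormula S n)) : MFormula S n :=
  l.foldr .and .top

/-- `π(r)`. -/
def Rule.toM {S : Signature.{u, v}} (r : Rule S) : MFormula S 0 :=
  .imp (.and (MFormula.conj (r.pos.map fun a => .knows a.toFO.toM))
      (MFormula.conj (r.neg.map fun b => .naf b.toFO.toM)))
    (.knows r.head.toFO.toM)

/-- A hybrid MKNF knowledge base `(𝓞, 𝓟)`: the first-order translation `π(𝓞)` of the description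
logic part, and a finite set of ground rules. -/
structure HybridKB (S : Signature.{u, v}) where
  onto : FOFormula S 0
  rules : Finset (Rule S)

namespace HybridKB

variable {S : Signature.{u, v}} (K : HybridKB S)

/-- `π(𝓚) = K π(𝓞) ∧ π(𝓟)`. -/
def toM : MFormula S 0 :=
  .and (.knows K.onto.toM) (MFormula.conj (K.rules.toList.map Rule.toM))

/-- `KA(𝓚)`: the modal atoms `K φ` such that `K φ` or `not φ` occurs in the rules. -/
def KA : Set (GroundAtom S) :=
  {a | ∃ r ∈ K.rules, a = r.head ∨ a ∈ r.pos ∨ a ∈ r.neg}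

/-- `body⁺(r)` as a subset of `KA(𝓚)`, for a rule `r` of `𝓚`. -/
def bodyPos (r : Rule S) : Set K.KA := {a | a.1 ∈ r.pos}

/-- `K(body⁻(r))` as a subset of `KA(𝓚)`, for a rule `r` of `𝓚`. -/
def bodyNeg (r : Rule S) : Set K.KA := {a | a.1 ∈ r.neg}

/-- The objective knowledge `OB_{𝓞,X} = {π(𝓞)} ∪ {ξ | K ξ ∈ X}`. -/
def OB (X : Set K.KA) : Set (FOFormula S 0) :=
  {K.onto} ∪ {ξ | ∃ a ∈ X, ξ = a.1.toFO}

/-- `{I | I ⊨ OB_{𝓞,X}}`. -/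
def modelsOf (X : Set K.KA) : Set (Interp S) := {I | I.Models (K.OB X)}

/-- `Ψ_𝓚(T, P)₁` (which is also the first component of `Φ_𝓚(T, P)`). -/
def psi₁ (T P : Set K.KA) : Set K.KA :=
  {a | Entails (K.OB T) a.1.toFO} ∪
  {a | ∃ r ∈ K.rules, r.head = a.1 ∧ K.bodyPos r ⊆ T ∧ K.bodyNeg r ∩ P = ∅}

/-- `Ψ_𝓚(T, P)₂`. -/
def psi₂ (T P : Set K.KA) : Set K.KA :=
  {a | Entails (K.OB P) a.1.toFO} ∪
  {a | ∃ r ∈ K.rules, r.head = a.1 ∧ ¬ Entails (K.OB T) (.neg a.1.toFO) ∧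
    K.bodyPos r ⊆ P ∧ K.bodyNeg r ∩ T = ∅ ∧
    ¬ ∃ r' ∈ K.rules, r'.neg = [] ∧ a ∈ K.bodyPos r' ∧
      Entails (K.OB T) (.neg r'.head.toFO) ∧ K.bodyPos r' \ {a} ⊆ T}

theorem entails_mono {X Y : Set K.KA} (h : X ⊆ Y) {ξ : FOFormula S 0}
    (hX : Entails (K.OB X) ξ) : Entails (K.OB Y) ξ := by
  intro I hI
  refine hX I fun ζ hζ => hI ζ ?_
  rcases hζ with hζ | ⟨a, ha, rfl⟩
  · exact Or.inl hζ
  · exact Or.inr ⟨a, h ha, rfl⟩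

theorem inter_empty_mono {A X Y : Set K.KA} (h : X ⊆ Y) (hY : A ∩ Y = ∅) : A ∩ X = ∅ :=
  Set.subset_eq_empty (Set.inter_subset_inter_right A h) hY

/-- The approximator `Ψ_𝓚` on the product bilattice of the power set of `KA(𝓚)`. -/
def Psi : Approximator (Set K.KA) where
  toFun p := (K.psi₁ p.1 p.2, K.psi₂ p.1 p.2)
  mono := by
    rintro ⟨T₁, P₁⟩ ⟨T₂, P₂⟩ ⟨hT, hP⟩
    constructor
    · rintro a (ha | ⟨r, hr, hh, hp, hn⟩)
      · exact Or.inl (K.entails_mono hT ha)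
      · exact Or.inr ⟨r, hr, hh, hp.trans hT, K.inter_empty_mono hP hn⟩
    · rintro a (ha | ⟨r, hr, hh, he, hp, hn, hb⟩)
      · exact Or.inl (K.entails_mono hP ha)
      · refine Or.inr ⟨r, hr, hh, fun h => he (K.entails_mono hT h), hp.trans hP,
          K.inter_empty_mono hT hn, ?_⟩
        rintro ⟨r', hr', hpos, hmem, hent, hsub⟩
        exact hb ⟨r', hr', hpos, hmem, K.entails_mono hT hent, hsub.trans hT⟩
  exact := by
    intro X h
    refine le_antisymm h ?_
    rintro a (ha | ⟨r, hr, hh, -, hp, hn, -⟩)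
    · exact Or.inl ha
    · exact Or.inr ⟨r, hr, hh, hp, hn⟩

/-- The interpretation pair `(M, N)` induces the partition `(T, P)` of `KA(𝓚)`: `T`, `P \ T` and
the complement of `P` consist of the modal atoms that are true, undefined and false in `(M, N)`. -/
def Induces (M N : Set (Interp S)) (T P : Set K.KA) : Prop :=
  ∀ a : K.KA,
    (a ∈ T ↔ ∀ I ∈ M, (MFormula.knows a.1.toFO.toM).eval (M, N) (M, N) I Fin.elim0 = tt) ∧
    (a ∉ P ↔ ∀ I ∈ M, (MFormula.knows a.1.toFO.toM).eval (M, N) (M, N) I Fin.elim0 = ff) ∧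
    (a ∈ P \ T ↔ ∀ I ∈ M, (MFormula.knows a.1.toFO.toM).eval (M, N) (M, N) I Fin.elim0 = uu)

end HybridKB

end HybridMKNF

end

namespace HybridMKNF

universe u v

variable {S : Signature.{u, v}}

/-! A truth value is determined by the two tests `tt ≤ ·` and `uu ≤ ·`, and on rules each test is
two-valued: at `tt`, `K` reads the first set of its pair and `not` the second set of the other pair;
at `uu` these roles are swapped. Hence `K.toM` is true at `(M', N')` against `(M, N)` exactly when
`M'` knows `onto`, `M'` obeys the rules with `not` read in `N`, and `N'` obeys them with `not` read
in `M` (`HybridKB.eval_toM_eq_tt_iff`). Obeying the rules amounts to closure of the known atoms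
under `psi₁` (`psi₁_known_subset`, `known_head_of_psi₁_subset`), so maximality of `(M, N)` becomes
leastness: `T` and `P` are the least fixpoints of `Ψ₁(·, P)` and `Ψ₁(·, T)`. Finally, `Ψ₂(T, ·)` is
`Ψ₁(·, T)` with extra guards against inconsistency. These never act when the least fixpoint of
`Ψ₁(·, T)` is satisfiable and contains `T`, and then the two least fixpoints coincide
(`lfp_snd_eq_lfp_fst`). -/

open Classical in
theorem FOFormula.eval_toM (MM NN : Set (Interp S) × Set (Interp S)) {n : ℕ} (φ : FOFormula S n)
    (I : Interp S) (val : Fin n → Name S) :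
    φ.toM.eval MM NN I val = if φ.Holds I val then tt else ff := by
  induction φ with
  | top => simp [FOFormula.toM, MFormula.eval, FOFormula.Holds]
  | atom R ts => rw [FOFormula.toM, MFormula.eval, FOFormula.Holds]
  | neg φ ih =>
    rw [FOFormula.toM, MFormula.eval, FOFormula.Holds, ih]
    by_cases h : φ.Holds I val <;> simp only [h] <;> decide
  | and φ ψ ih₁ ih₂ =>
    rw [FOFormula.toM, MFormula.eval, FOFormula.Holds, ih₁, ih₂]
    by_cases h₁ : φ.Holds I val <;> by_cases h₂ : ψ.Holds I val <;>
      simp only [h₁, h₂] <;> decide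
  | ex φ ih =>
    simp only [FOFormula.toM, MFormula.eval, ih]
    by_cases h : (FOFormula.ex φ).Holds I val
    · rw [if_pos h]
      obtain ⟨α, hα⟩ := h
      exact le_antisymm (Fin.le_last (n := 2) _) (le_iSup_of_le α (if_pos hα).ge)
    · rw [if_neg h]
      exact le_antisymm (iSup_le fun α => (if_neg fun hα => h ⟨α, hα⟩).le) (Fin.zero_le _)

theorem FOFormula.eval_toM_eq_tt_iff (MM NN : Set (Interp S) × Set (Interp S)) {n : ℕ}
    (φ : FOFormula S n) (I : Interp S) (val : Fin n → Name S) :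
    φ.toM.eval MM NN I val = tt ↔ φ.Holds I val := by
  rw [eval_toM]
  split_ifs with h
  · exact iff_of_true rfl h
  · exact iff_of_false (by decide) h

theorem FOFormula.eval_toM_eq_ff_iff (MM NN : Set (Interp S) × Set (Interp S)) {n : ℕ}
    (φ : FOFormula S n) (I : Interp S) (val : Fin n → Name S) :
    φ.toM.eval MM NN I val = ff ↔ ¬ φ.Holds I val := by
  rw [eval_toM]
  split_ifs with h
  · exact iff_of_false (by decide) (not_not_intro h)
  · exact iff_of_true rfl h

/-! ### Truth values through their two thresholds -/

theorem TruthVal.eq_tt_iff (x : TruthVal) : x = tt ↔ tt ≤ x := by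
  revert x; decide

theorem TruthVal.eq_ff_iff (x : TruthVal) : x = ff ↔ ¬ uu ≤ x := by
  revert x; decide

theorem TruthVal.eq_uu_iff (x : TruthVal) : x = uu ↔ uu ≤ x ∧ ¬ tt ≤ x := by
  revert x; decide

theorem TruthVal.le_iff (x y : TruthVal) : x ≤ y ↔ (tt ≤ x → tt ≤ y) ∧ (uu ≤ x → uu ≤ y) := by
  revert x y; decide

theorem TruthVal.tt_le_ite_iff {p q : Prop} [Decidable p] [Decidable q] :
    tt ≤ (if p then tt else if q then ff else uu) ↔ p := by
  by_cases hp : p <;> by_cases hq : q <;> simp only [hp, hq, if_true, if_false] <;> decide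

/-- Exclusivity matters because the `p` branch takes precedence; for modal atoms it comes from the
inclusion inside the pair. -/
theorem TruthVal.uu_le_ite_iff {p q : Prop} [Decidable p] [Decidable q] (h : p → ¬ q) :
    uu ≤ (if p then tt else if q then ff else uu) ↔ ¬ q := by
  by_cases hp : p
  · rw [if_pos hp]
    exact ⟨fun _ => h hp, fun _ => by decide⟩
  · rw [if_neg hp]
    by_cases hq : q <;> simp only [hq, if_true, if_false] <;> decide

/-- `ξ` holds in every interpretation of `M`. -/
def Known (M : Set (Interp S)) (ξ : FOFormula S 0) : Prop := ∀ J ∈ M, ξ.Holds J Fin.elim0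

theorem Known.anti {M N : Set (Interp S)} (h : N ⊆ M) {ξ : FOFormula S 0} (hM : Known M ξ) :
    Known N ξ := fun J hJ => hM J (h hJ)

/-! ### Reduction of modal evaluation to two-valued knowledge -/

section Evaluation

open Classical

variable {MM NN : Set (Interp S) × Set (Interp S)}

theorem forall_eval_toM_eq_tt_iff {M : Set (Interp S)} (ξ : FOFormula S 0) :
    (∀ J ∈ M, ξ.toM.eval MM NN J Fin.elim0 = tt) ↔ Known M ξ :=
  forall₂_congr fun J _ => ξ.eval_toM_eq_tt_iff MM NN J _

theorem exists_eval_toM_eq_ff_iff {M : Set (Interp S)} (ξ : FOFormula S 0) :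
    (∃ J ∈ M, ξ.toM.eval MM NN J Fin.elim0 = ff) ↔ ¬ Known M ξ := by
  simp only [FOFormula.eval_toM_eq_ff_iff, Known, not_forall, exists_prop]

theorem tt_le_eval_knows (ξ : FOFormula S 0) (I : Interp S) :
    tt ≤ (MFormula.knows ξ.toM).eval MM NN I Fin.elim0 ↔ Known MM.1 ξ := by
  rw [MFormula.eval]
  exact TruthVal.tt_le_ite_iff.trans (forall_eval_toM_eq_tt_iff ξ)

theorem uu_le_eval_knows (hM : MM.2 ⊆ MM.1) (ξ : FOFormula S 0) (I : Interp S) :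
    uu ≤ (MFormula.knows ξ.toM).eval MM NN I Fin.elim0 ↔ Known MM.2 ξ := by
  rw [MFormula.eval]
  exact (TruthVal.uu_le_ite_iff fun h h' => (exists_eval_toM_eq_ff_iff ξ).1 h'
    (((forall_eval_toM_eq_tt_iff ξ).1 h).anti hM)).trans
    ((exists_eval_toM_eq_ff_iff ξ).not.trans not_not)

theorem tt_le_eval_naf (ξ : FOFormula S 0) (I : Interp S) :
    tt ≤ (MFormula.naf ξ.toM).eval MM NN I Fin.elim0 ↔ ¬ Known NN.2 ξ := by
  rw [MFormula.eval]
  exact TruthVal.tt_le_ite_iff.trans (exists_eval_toM_eq_ff_iff ξ)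

theorem uu_le_eval_naf (hN : NN.2 ⊆ NN.1) (ξ : FOFormula S 0) (I : Interp S) :
    uu ≤ (MFormula.naf ξ.toM).eval MM NN I Fin.elim0 ↔ ¬ Known NN.1 ξ := by
  rw [MFormula.eval]
  exact (TruthVal.uu_le_ite_iff fun h h' => (exists_eval_toM_eq_ff_iff ξ).1 h
    (((forall_eval_toM_eq_tt_iff ξ).1 h').anti hN)).trans (forall_eval_toM_eq_tt_iff ξ).not

theorem le_eval_conj (c : TruthVal) {n : ℕ} (l : List (MFormula S n)) (I : Interp S)
    (val : Fin n → Name S) :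
    c ≤ (MFormula.conj l).eval MM NN I val ↔ ∀ φ ∈ l, c ≤ φ.eval MM NN I val := by
  induction l with
  | nil => simpa [MFormula.conj, MFormula.eval] using Fin.le_last c
  | cons φ l ih =>
    have : MFormula.conj (φ :: l) = .and φ (MFormula.conj l) := rfl
    rw [this, MFormula.eval, le_min_iff, ih, List.forall_mem_cons]

theorem tt_le_eval_rule (hM : MM.2 ⊆ MM.1) (hN : NN.2 ⊆ NN.1) (r : Rule S) (I : Interp S) :
    tt ≤ r.toM.eval MM NN I Fin.elim0 ↔
      ((∀ a ∈ r.pos, Known MM.1 a.toFO) → (∀ b ∈ r.neg, ¬ Known NN.2 b.toFO) →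
        Known MM.1 r.head.toFO) ∧
      ((∀ a ∈ r.pos, Known MM.2 a.toFO) → (∀ b ∈ r.neg, ¬ Known NN.1 b.toFO) →
        Known MM.2 r.head.toFO) := by
  have key : ∀ x y : TruthVal, tt ≤ (if x ≤ y then tt else ff) ↔ x ≤ y := by decide
  rw [Rule.toM, MFormula.eval, key, TruthVal.le_iff, tt_le_eval_knows, uu_le_eval_knows hM]
  -- `MFormula.eval.eq_4` is the defining equation of `eval` at `.and`.
  simp only [MFormula.eval.eq_4, le_min_iff, le_eval_conj, List.forall_mem_map, and_imp,
    tt_le_eval_knows, uu_le_eval_knows hM, tt_le_eval_naf, uu_le_eval_naf hN]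

theorem HybridKB.eval_toM_eq_tt_iff (K : HybridKB S) (hM : MM.2 ⊆ MM.1) (hN : NN.2 ⊆ NN.1)
    (I : Interp S) :
    K.toM.eval MM NN I Fin.elim0 = tt ↔ Known MM.1 K.onto ∧ ∀ r ∈ K.rules,
      ((∀ a ∈ r.pos, Known MM.1 a.toFO) → (∀ b ∈ r.neg, ¬ Known NN.2 b.toFO) →
        Known MM.1 r.head.toFO) ∧
      ((∀ a ∈ r.pos, Known MM.2 a.toFO) → (∀ b ∈ r.neg, ¬ Known NN.1 b.toFO) →
        Known MM.2 r.head.toFO) := by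
  rw [TruthVal.eq_tt_iff, HybridKB.toM, MFormula.eval, le_min_iff, tt_le_eval_knows, le_eval_conj]
  simp only [List.forall_mem_map, Finset.mem_toList, tt_le_eval_rule hM hN]

end Evaluation

/-! ### Closure under `psi₁` and comparison with `psi₂` -/

namespace HybridKB

variable (K : HybridKB S)

theorem entails_of_mem {X : Set K.KA} {a : K.KA} (h : a ∈ X) : Entails (K.OB X) a.1.toFO :=
  fun _ hI => hI _ (Or.inr ⟨a, h, rfl⟩)

theorem entails_onto (X : Set K.KA) : Entails (K.OB X) K.onto :=
  fun _ hI => hI _ (Or.inl rfl)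

theorem modelsOf_anti {X Y : Set K.KA} (h : X ⊆ Y) : K.modelsOf Y ⊆ K.modelsOf X := by
  rintro I hI ξ (hξ | ⟨a, ha, rfl⟩)
  · exact hI _ (Or.inl hξ)
  · exact hI _ (Or.inr ⟨a, h ha, rfl⟩)

theorem subset_modelsOf {M : Set (Interp S)} {X : Set K.KA} (hO : Known M K.onto)
    (hX : ∀ a ∈ X, Known M a.1.toFO) : M ⊆ K.modelsOf X := by
  rintro I hI ξ (rfl | ⟨a, ha, rfl⟩)
  · exact hO I hI
  · exact hX a ha I hI

theorem not_entails_neg {X : Set K.KA} (hX : Satisfiable (K.OB X)) {ξ : FOFormula S 0}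
    (h : Entails (K.OB X) ξ) : ¬ Entails (K.OB X) (.neg ξ) := by
  obtain ⟨I, hI⟩ := hX
  exact fun h' => h' I hI (h I hI)

theorem head_mem_KA {r : Rule S} (hr : r ∈ K.rules) : r.head ∈ K.KA := ⟨r, hr, Or.inl rfl⟩

theorem pos_mem_KA {r : Rule S} (hr : r ∈ K.rules) {a : GroundAtom S} (ha : a ∈ r.pos) :
    a ∈ K.KA := ⟨r, hr, Or.inr (Or.inl ha)⟩

theorem neg_mem_KA {r : Rule S} (hr : r ∈ K.rules) {a : GroundAtom S} (ha : a ∈ r.neg) :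
    a ∈ K.KA := ⟨r, hr, Or.inr (Or.inr ha)⟩

theorem psi₁_anti (X : Set K.KA) {T P : Set K.KA} (h : T ⊆ P) : K.psi₁ X P ⊆ K.psi₁ X T := by
  rintro a (ha | ⟨r, hr, hh, hp, hn⟩)
  · exact Or.inl ha
  · exact Or.inr ⟨r, hr, hh, hp, K.inter_empty_mono h hn⟩

theorem psi₂_subset_psi₁ (T X : Set K.KA) : K.psi₂ T X ⊆ K.psi₁ X T := by
  rintro a (ha | ⟨r, hr, hh, -, hp, hn, -⟩)
  · exact Or.inl ha
  · exact Or.inr ⟨r, hr, hh, hp, hn⟩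

/-- The side conditions of `Ψ₂` are vacuous below a satisfiable pre-fixpoint of `Ψ₁(·, T)` that
contains `T`. -/
theorem psi₁_subset_psi₂ {T X Q : Set K.KA} (hTX : T ⊆ X) (hX : K.psi₁ X T ⊆ X)
    (hsat : Satisfiable (K.OB X)) (hQX : Q ⊆ X) : K.psi₁ Q T ⊆ K.psi₂ T Q := by
  rintro a (ha | ⟨r, hr, hh, hp, hn⟩)
  · exact Or.inl ha
  · have haX : a ∈ X := hX (Or.inr ⟨r, hr, hh, hp.trans hQX, hn⟩)
    refine Or.inr ⟨r, hr, hh, fun h => ?_, hp, hn, ?_⟩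
    · exact K.not_entails_neg hsat (K.entails_of_mem haX) (K.entails_mono hTX h)
    · rintro ⟨r', hr', hpos, -, hent, hsub⟩
      -- A blocking rule is positive with body inside `T ∪ {a} ⊆ X`, so it fires at `X`; its head
      -- then lies in `X` while `T ⊆ X` refutes it.
      have hb : (⟨r'.head, K.head_mem_KA hr'⟩ : K.KA) ∈ X := by
        refine hX (Or.inr ⟨r', hr', rfl, fun c hc => ?_, ?_⟩)
        · by_cases hca : c = a
          · exact hca ▸ haX
          · exact hTX (hsub ⟨hc, hca⟩)
        · ext c; simp [bodyNeg, hpos]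
      exact K.not_entails_neg hsat (K.entails_of_mem hb) (K.entails_mono hTX hent)

/-- The least fixpoint of `Ψ₂(T, ·)` stays below `X`, where the guards are vacuous, so it is closed
under `Ψ₁(·, T)` as well. -/
theorem lfp_snd_eq_lfp_fst {T X : Set K.KA} (hTX : T ⊆ X) (hX : K.psi₁ X T ⊆ X)
    (hsat : Satisfiable (K.OB X)) : (K.Psi.snd T).lfp = (K.Psi.fst T).lfp := by
  apply le_antisymm
  · refine OrderHom.lfp_le _ ?_
    exact (K.psi₂_subset_psi₁ T _).trans (K.Psi.fst T).map_lfp.le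
  · have hQX : (K.Psi.snd T).lfp ≤ X :=
      OrderHom.lfp_le _ ((K.psi₂_subset_psi₁ T X).trans hX)
    refine OrderHom.lfp_le _ ?_
    exact (K.psi₁_subset_psi₂ hTX hX hsat hQX).trans (K.Psi.snd T).map_lfp.le

theorem lfp_fst_anti {T P : Set K.KA} (h : T ⊆ P) : (K.Psi.fst P).lfp ≤ (K.Psi.fst T).lfp :=
  OrderHom.lfp_le _ ((K.psi₁_anti _ h).trans (K.Psi.fst T).map_lfp.le)

/-- The atoms known in a rule-satisfying pair `(M', N')` are closed under `Ψ₁`. -/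
theorem psi₁_known_subset {M' : Set (Interp S)} (hO : Known M' K.onto) {P : Set K.KA}
    {N : Set (Interp S)} (hN : ∀ b : K.KA, b ∉ P → ¬ Known N b.1.toFO)
    (hr : ∀ r ∈ K.rules, (∀ a ∈ r.pos, Known M' a.toFO) → (∀ b ∈ r.neg, ¬ Known N b.toFO) →
      Known M' r.head.toFO) :
    K.psi₁ {a | Known M' a.1.toFO} P ⊆ {a | Known M' a.1.toFO} := by
  rintro a (ha | ⟨r, hrK, hh, hp, hn⟩)
  -- `M'` consists of models of the atoms it knows, so it knows whatever they entail.
  · exact fun J hJ => ha J (K.subset_modelsOf hO (fun _ h => h) hJ)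
  · change Known M' a.1.toFO
    rw [← hh]
    refine hr r hrK (fun c hc => @hp ⟨c, K.pos_mem_KA hrK hc⟩ hc) fun b hb => ?_
    refine hN ⟨b, K.neg_mem_KA hrK hb⟩ fun hbP => ?_
    exact (Set.eq_empty_iff_forall_notMem.1 hn) ⟨b, K.neg_mem_KA hrK hb⟩ ⟨hb, hbP⟩

/-- The models of a set of atoms that is closed under `Ψ₁(·, P)` satisfy the rules. -/
theorem known_head_of_psi₁_subset {X P : Set K.KA} (hX : K.psi₁ X P ⊆ X) {N : Set (Interp S)}
    (hN : ∀ b ∈ P, Known N b.1.toFO) {r : Rule S} (hr : r ∈ K.rules)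
    (hpos : ∀ a ∈ r.pos, Known (K.modelsOf X) a.toFO) (hneg : ∀ b ∈ r.neg, ¬ Known N b.toFO) :
    Known (K.modelsOf X) r.head.toFO := by
  refine K.entails_of_mem (a := ⟨r.head, K.head_mem_KA hr⟩)
    (hX (Or.inr ⟨r, hr, rfl, fun c hc => hX (Or.inl (hpos c.1 hc)), ?_⟩))
  exact Set.eq_empty_iff_forall_notMem.2 fun b hb => hneg b.1 hb.1 (hN b hb.2)

/-- Modal values do not depend on `I`, and the clause for `uu` follows from the other two. -/
theorem induces_iff {T P : Set K.KA} {M N : Set (Interp S)} (hM : M.Nonempty) (hNM : N ⊆ M) :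
    K.Induces M N T P ↔
      ∀ a : K.KA, (a ∈ T ↔ Known M a.1.toFO) ∧ (a ∈ P ↔ Known N a.1.toFO) := by
  have hc : ∀ p : Prop, (∀ I ∈ M, p) ↔ p :=
    fun p => ⟨fun h => h _ hM.some_mem, fun h _ _ => h⟩
  have h₁ := fun (a : K.KA) I => tt_le_eval_knows (MM := (M, N)) (NN := (M, N)) a.1.toFO I
  have h₂ := fun (a : K.KA) I => uu_le_eval_knows (MM := (M, N)) (NN := (M, N)) hNM a.1.toFO I
  simp only [Induces, TruthVal.eq_tt_iff, TruthVal.eq_ff_iff, TruthVal.eq_uu_iff, h₁, h₂, hc,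
    Set.mem_sdiff]
  refine forall_congr' fun a => ?_
  tauto

/-! ### Models versus stable fixpoints -/

theorem isThreeValuedModel_of_stable {T P : Set K.KA} (hTP : T ⊆ P)
    (hT : (K.Psi.fst P).lfp = T) (hP : (K.Psi.snd T).lfp = P) (hPT : K.psi₁ P T ⊆ P)
    (hsat : Satisfiable (K.OB P)) :
    IsThreeValuedModel (K.modelsOf T) (K.modelsOf P) K.toM ∧
      K.Induces (K.modelsOf T) (K.modelsOf P) T P := by
  have hTc : K.psi₁ T P ⊆ T := by
    have := (K.Psi.fst P).map_lfp.le
    rwa [hT] at this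
  have hNM : K.modelsOf P ⊆ K.modelsOf T := K.modelsOf_anti hTP
  have hN : (K.modelsOf P).Nonempty := hsat
  have hkT : ∀ a : K.KA, a ∈ T ↔ Known (K.modelsOf T) a.1.toFO :=
    fun a => ⟨K.entails_of_mem, fun h => hTc (Or.inl h)⟩
  have hkP : ∀ a : K.KA, a ∈ P ↔ Known (K.modelsOf P) a.1.toFO :=
    fun a => ⟨K.entails_of_mem, fun h => hPT (Or.inl h)⟩
  refine ⟨⟨⟨hN, hNM⟩, fun I _ => ?_, ?_⟩,
    (K.induces_iff (hN.mono hNM) hNM).2 fun a => ⟨hkT a, hkP a⟩⟩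
  · refine (K.eval_toM_eq_tt_iff hNM hNM I).2 ⟨K.entails_onto T, fun r hr => ⟨?_, ?_⟩⟩
    · exact K.known_head_of_psi₁_subset hTc (fun b => (hkP b).1) hr
    · exact K.known_head_of_psi₁_subset hPT (fun b => (hkT b).1) hr
  · rintro M' N' ⟨hN', hNM'⟩ hMM hNN hne -
    by_contra! hall
    obtain ⟨J, hJ⟩ := hN'
    obtain ⟨hO, hr⟩ := (K.eval_toM_eq_tt_iff hNM' hNM J).1 (hall J (hNM' hJ))
    -- By leastness, a larger pair satisfying the knowledge base still knows all of `T` and `P`,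
    -- which forces it back inside `(M, N)`.
    have hT' : T ⊆ {a | Known M' a.1.toFO} := by
      refine hT.symm.subset.trans (OrderHom.lfp_le _ ?_)
      exact K.psi₁_known_subset hO (fun b hb => mt (hkP b).2 hb) fun r h => (hr r h).1
    have hP' : P ⊆ {a | Known N' a.1.toFO} := by
      refine hP.symm.subset.trans (OrderHom.lfp_le _ ?_)
      exact (K.psi₂_subset_psi₁ T _).trans
        (K.psi₁_known_subset (hO.anti hNM') (fun b hb => mt (hkT b).2 hb) fun r h => (hr r h).2)
    rcases hne with h | h
    · exact h (hMM.antisymm (K.subset_modelsOf hO hT'))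
    · exact h (hNN.antisymm (K.subset_modelsOf (hO.anti hNM') hP'))

/-- The models of the two least fixpoints form a pair that satisfies the knowledge base and extends
`(M, N)`. Maximality makes the pairs equal, and closure of the fixpoints under entailment then
recovers `T` and `P`. -/
theorem stable_of_isThreeValuedModel {T P : Set K.KA}
    (hmod : IsThreeValuedModel (K.modelsOf T) (K.modelsOf P) K.toM)
    (hind : K.Induces (K.modelsOf T) (K.modelsOf P) T P) :
    T ⊆ P ∧ (K.Psi.fst P).lfp = T ∧ (K.Psi.snd T).lfp = P ∧ K.psi₁ P T ⊆ P ∧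
      Satisfiable (K.OB P) := by
  obtain ⟨⟨hN, hNM⟩, heval, hmin⟩ := hmod
  rw [K.induces_iff (hN.mono hNM) hNM] at hind
  have hTP : T ⊆ P := fun a ha => (hind a).2.2 (((hind a).1.1 ha).anti hNM)
  obtain ⟨J, hJ⟩ := hN
  obtain ⟨hO, hr⟩ := (K.eval_toM_eq_tt_iff hNM hNM J).1 (heval J (hNM hJ))
  have hTeq : {a : K.KA | Known (K.modelsOf T) a.1.toFO} = T :=
    Set.ext fun a => (hind a).1.symm
  have hPeq : {a : K.KA | Known (K.modelsOf P) a.1.toFO} = P :=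
    Set.ext fun a => (hind a).2.symm
  have hTc : K.psi₁ T P ⊆ T := by
    have := K.psi₁_known_subset hO (fun b hb => mt (hind b).2.2 hb) fun r h => (hr r h).1
    rwa [hTeq] at this
  have hPc : K.psi₁ P T ⊆ P := by
    have := K.psi₁_known_subset (hO.anti hNM) (fun b hb => mt (hind b).1.2 hb)
      fun r h => (hr r h).2
    rwa [hPeq] at this
  have hsat : Satisfiable (K.OB P) := ⟨J, hJ⟩
  have hlfp := K.lfp_snd_eq_lfp_fst hTP hPc hsat
  set T₀ := (K.Psi.fst P).lfp with hT₀
  set P₀ := (K.Psi.snd T).lfp with hP₀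
  have hT₀T : T₀ ⊆ T := OrderHom.lfp_le _ hTc
  have hP₀P : P₀ ⊆ P := hlfp.le.trans (OrderHom.lfp_le _ hPc)
  have hTP₀ : T₀ ⊆ P₀ := (K.lfp_fst_anti hTP).trans hlfp.ge
  have hT₀c : K.psi₁ T₀ P ⊆ T₀ := (K.Psi.fst P).map_lfp.le
  have hP₀c : K.psi₁ P₀ T ⊆ P₀ := by
    rw [hlfp]
    exact (K.Psi.fst T).map_lfp.le
  have hMM := K.modelsOf_anti hT₀T
  have hNN := K.modelsOf_anti hP₀P
  have hNM₀ := K.modelsOf_anti hTP₀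
  by_cases heq : K.modelsOf T = K.modelsOf T₀ ∧ K.modelsOf P = K.modelsOf P₀
  · refine ⟨hTP, hT₀T.antisymm fun a ha => ?_, hP₀P.antisymm fun a ha => ?_, hPc, hsat⟩
    · have := (hind a).1.1 ha
      rw [heq.1] at this
      exact hT₀c (Or.inl this)
    · have := (hind a).2.1 ha
      rw [heq.2] at this
      exact hP₀c (Or.inl this)
  · refine absurd (hmin (K.modelsOf T₀) (K.modelsOf P₀) ⟨⟨J, hNN hJ⟩, hNM₀⟩ hMM hNN
      (not_and_or.1 heq) fun h => ?_) ?_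
    -- The competitor must be exact when `M = N`: then `T = P`, so both of its components come from
    -- the least fixpoint of `Ψ₁(·, T)`.
    · have : T = P := by rw [← hTeq, h, hPeq]
      rw [hlfp, hT₀, this]
    · push Not
      refine fun I _ => (K.eval_toM_eq_tt_iff hNM₀ hNM I).2
        ⟨K.entails_onto T₀, fun r hr => ⟨?_, ?_⟩⟩
      · exact K.known_head_of_psi₁_subset hT₀c (fun b => (hind b).2.1) hr
      · exact K.known_head_of_psi₁_subset hP₀c (fun b => (hind b).1.1) hr

theorem isThreeValuedModel_and_induces_iff (T P : Set K.KA) :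
    (IsThreeValuedModel (K.modelsOf T) (K.modelsOf P) K.toM ∧
        K.Induces (K.modelsOf T) (K.modelsOf P) T P) ↔
      (K.Psi.IsConsistentStable T P ∧ Satisfiable (K.OB (K.Psi.fst T).lfp)) := by
  constructor
  · rintro ⟨hmod, hind⟩
    obtain ⟨hTP, hT, hP, hPc, hsat⟩ := K.stable_of_isThreeValuedModel hmod hind
    refine ⟨⟨hTP, Prod.ext hT hP⟩, ?_⟩
    -- The required satisfiability is that of `OB P`, that is, nonemptiness of `N`.
    rwa [← K.lfp_snd_eq_lfp_fst hTP hPc hsat, hP]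
  · rintro ⟨⟨hTP, hst⟩, hsat⟩
    have hT : (K.Psi.fst P).lfp = T := congrArg Prod.fst hst
    have hP : (K.Psi.snd T).lfp = P := congrArg Prod.snd hst
    have hPX : P = (K.Psi.fst T).lfp :=
      hP.symm.trans (K.lfp_snd_eq_lfp_fst (hT.symm.le.trans (K.lfp_fst_anti hTP))
        (K.Psi.fst T).map_lfp.le hsat)
    have hPc : K.psi₁ P T ⊆ P := by
      rw [hPX]
      exact (K.Psi.fst T).map_lfp.le
    exact K.isThreeValuedModel_of_stable hTP hT hP hPc (by rwa [← hPX] at hsat)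

/-! ### Least fixpoints on intervals -/

theorem isConsistentStable_iff_onIntervals {T P : Set K.KA}
    (hsat : Satisfiable (K.OB (K.Psi.fst T).lfp)) :
    K.Psi.IsConsistentStable T P ↔ K.Psi.IsConsistentStableOnIntervals T P := by
  have hX : K.psi₁ (K.Psi.fst T).lfp T ⊆ (K.Psi.fst T).lfp := (K.Psi.fst T).map_lfp.le
  constructor
  · rintro ⟨hTP, hst⟩
    have hT : (K.Psi.fst P).lfp = T := congrArg Prod.fst hst
    have hP : (K.Psi.snd T).lfp = P := congrArg Prod.snd hst
    have hPX := hP.symm.trans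
      (K.lfp_snd_eq_lfp_fst (hT.symm.le.trans (K.lfp_fst_anti hTP)) hX hsat)
    have hPc : K.psi₁ P T ⊆ P := by
      rw [hPX]
      exact hX
    refine ⟨hTP, ⟨fun z hz => ⟨bot_le, ?_⟩, ⟨⟨bot_le, hTP⟩, ?_⟩, fun z hz => ?_⟩,
      fun z hz => ⟨?_, le_top⟩, ⟨⟨hTP, le_top⟩, ?_⟩, fun z hz => ?_⟩
    -- `Ψ₁(z, P) ⊆ Ψ₁(P, P) ⊆ Ψ₁(P, T) ⊆ P`.
    · exact ((K.Psi.fst P).monotone hz.2).trans ((K.psi₁_anti P hTP).trans hPc)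
    · have := (K.Psi.fst P).map_lfp
      rwa [hT] at this
    · exact hT.symm.le.trans (OrderHom.lfp_le _ hz.2.le)
    · exact fun a ha => Or.inl (K.entails_of_mem (hz.1 ha))
    · have := (K.Psi.snd T).map_lfp
      rwa [hP] at this
    · exact hP.symm.le.trans (OrderHom.lfp_le _ hz.2.le)
  · rintro ⟨hTP, ⟨-, ⟨-, hTfix⟩, hTle⟩, -, ⟨-, hPfix⟩, hPle⟩
    -- Conversely, the unrestricted least fixpoints already lie in the intervals; for the second,
    -- `T` is below the least fixpoint of `Ψ₁(·, T)`, which equals that of `Ψ₂(T, ·)`.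
    have h₁ : (K.Psi.fst P).lfp ≤ T := OrderHom.lfp_le _ hTfix.le
    have hT : (K.Psi.fst P).lfp = T :=
      h₁.antisymm (hTle ⟨⟨bot_le, h₁.trans hTP⟩, (K.Psi.fst P).map_lfp⟩)
    have hTX : T ⊆ (K.Psi.fst T).lfp := hT.symm.le.trans (K.lfp_fst_anti hTP)
    have h₂ : (K.Psi.snd T).lfp ≤ P := OrderHom.lfp_le _ hPfix.le
    have hTQ : T ≤ (K.Psi.snd T).lfp := hTX.trans (K.lfp_snd_eq_lfp_fst hTX hX hsat).ge
    exact ⟨hTP, Prod.ext hT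
      (h₂.antisymm (hPle ⟨⟨hTQ, le_top⟩, (K.Psi.snd T).map_lfp⟩))⟩

end HybridKB

end HybridMKNF

theorem theorem6 {S : HybridMKNF.Signature} (K : HybridMKNF.HybridKB S) (T P : Set K.KA) :
    ((HybridMKNF.IsThreeValuedModel (K.modelsOf T) (K.modelsOf P) K.toM ∧
        K.Induces (K.modelsOf T) (K.modelsOf P) T P) ↔
      (K.Psi.IsConsistentStable T P ∧
        HybridMKNF.Satisfiable (K.OB (K.Psi.fst T).lfp))) ∧
    ((HybridMKNF.IsThreeValuedModel (K.modelsOf T) (K.modelsOf P) K.toM ∧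
        K.Induces (K.modelsOf T) (K.modelsOf P) T P) ↔
      (K.Psi.IsConsistentStableOnIntervals T P ∧
        HybridMKNF.Satisfiable (K.OB (K.Psi.fst T).lfp))) := by
  exact ⟨K.isThreeValuedModel_and_induces_iff T P,
    (K.isThreeValuedModel_and_induces_iff T P).trans
      -- The two notions of stability are compared only under the shared satisfiability conjunct.
      (and_congr_left K.isConsistentStable_iff_onIntervals)⟩
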